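/- Let $V\subset\mathbb{R}^2$ be a finite set of $n$ terminals, $O\in\mathbb{R}^2$ a depot and $k\ge 1$ an integer capacity. For a finite set $U$ of terminals, a solution of the unit-demand Euclidean capacitated vehicle routing problem $(U,O,k)$ is a finite collection of closed tours, each of which starts and ends at $O$ and visits at most $k$ terminals of $U$, such that every terminal of $U$ is visited by some tour; its cost is the total Euclidean length of its tours. Let $M$ be a positive integer, and let $\theta(v)\in[0,2\pi)$ denote the polar angle of $v$ with respect to $O$ (any value in $[0,2\pi)$ is allowed if $v=O$). Consider the following algorithm. Sort the terminals as $u_1,\dots,u_n$ with $\theta(u_1)\le\dots\le\theta(u_n)$. For each $1\le i\le\left\lceil\frac{n}{Mk}\right\rceil$, let $V_i=\{u_j:(i-1)Mk<j\le iMk\}$ and compute a $\left(1+\frac1M\right)$-approximate solution $S_i$ of $(V_i,O,k)$, that is, a solution whose cost is at most $1+\frac1M$ times the minimum cost of a solution of $(V_i,O,k)$. Return the union of all $S_i$. Let $\mathrm{sol}(M)$ be the cost of the returned solution, for any way of breaking ties and any choice of the approximate solutions $S_i$. Let $T_0^*$ be the minimum length of a traveling salesman tour on $V$, let $\mathrm{rad}_\infty=\frac{2}{k}\sum_{v\in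 V}d(O,v)$, where $d$ is the Euclidean distance, and let $D$ be the diameter of $V\cup\{O\}$. Then \[\mathrm{sol}(M)\le\left(1+\frac1M\right)\left(T_0^*+\mathrm{rad}_\infty+\frac{3\pi D}{2}\left\lceil\frac{n}{Mk}\right\rceil\right).\] -/

import Mathlib

open scoped ENNReal

noncomputable section

namespace CVRP

/-- The Euclidean plane. -/
abbrev Plane : Type := EuclideanSpace ℝ (Fin 2)

/-- Length of the polygonal path through the points of a list, in the order of the list. -/
def pathLength : List Plane → ℝ
  | [] => 0
  | [_] => 0
  | a :: b :: l => dist a b + pathLength (b :: l)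

/-- Length of the closed polygonal tour that visits the points of a list in order and then
returns to the first one. -/
def closedLength : List Plane → ℝ
  | [] => 0
  | a :: l => pathLength (a :: l ++ [a])

/-- A traveling salesman tour on the finite point set `P`: an ordering of its points. -/
def IsTSPTour (P : Finset Plane) (l : List Plane) : Prop :=
  l.Nodup ∧ ∀ v, v ∈ l ↔ v ∈ P

/-- Minimum cost of a traveling salesman tour on `P` (zero for the empty set). -/
def tspCost (P : Finset Plane) : ℝ :=
  sInf {c : ℝ | ∃ l, IsTSPTour P l ∧ c = closedLength l}

/-- The `R`-radial cost `(2 / k) * ∑ v ∈ V, min (d(O, v)) R`, for `R ∈ [0, ∞]`. -/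
def radialCost (V : Finset Plane) (O : Plane) (k : ℕ) (R : ℝ≥0∞) : ℝ :=
  2 / (k : ℝ) * ∑ v ∈ V, (min (edist O v) R).toReal

open Classical in
/-- The `R`-local cost: the minimum cost of a traveling salesman tour on the terminals at
distance at least `R` from the depot, for `R ∈ [0, ∞]`. -/
def localCost (V : Finset Plane) (O : Plane) (R : ℝ≥0∞) : ℝ :=
  tspCost (V.filter fun v => R ≤ edist O v)

/-- Cost of a vehicle tour: it leaves the depot `O`, makes the listed stops in order, and returns
to `O`. -/
def tourCost (O : Plane) (t : List Plane) : ℝ :=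
  pathLength (O :: t ++ [O])

/-- Total cost of a collection of vehicle tours. -/
def solutionCost (O : Plane) (S : List (List Plane)) : ℝ :=
  (S.map (tourCost O)).sum

/-- Feasible solutions of the unit-demand CVRP with terminals `U` and capacity `k` (feasibility
does not depend on the depot): every stop is a terminal, every tour visits at most `k` terminals,
and every terminal is visited by some tour. -/
structure IsSolution (U : Finset Plane) (k : ℕ) (S : List (List Plane)) : Prop where
  stops_mem : ∀ t ∈ S, ∀ v ∈ t, v ∈ U
  capacity : ∀ t ∈ S, {v | v ∈ t}.ncard ≤ k
  covers : ∀ v ∈ U, ∃ t ∈ S, v ∈ t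

/-- Cost of an optimal solution of the unit-demand CVRP `(U, O, k)`. -/
def opt (U : Finset Plane) (O : Plane) (k : ℕ) : ℝ :=
  sInf {c : ℝ | ∃ S, IsSolution U k S ∧ c = solutionCost O S}

/-- `S` is an `α`-approximate solution of the unit-demand CVRP `(U, O, k)`. -/
def IsApproxSolution (α : ℝ) (U : Finset Plane) (O : Plane) (k : ℕ)
    (S : List (List Plane)) : Prop :=
  IsSolution U k S ∧ solutionCost O S ≤ α * opt U O k

/-- `t ∈ [0, 2π)` is a polar angle of `v` with respect to `O`. It is unique if `v ≠ O`; for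
`v = O` every `t ∈ [0, 2π)` is admitted. -/
def IsPolarAngle (O v : Plane) (t : ℝ) : Prop :=
  0 ≤ t ∧ t < 2 * Real.pi ∧
    v 0 = O 0 + dist O v * Real.cos t ∧ v 1 = O 1 + dist O v * Real.sin t

/-- The number `⌈n / (M k)⌉` of groups formed out of `n` terminals. -/
def numGroups (n M k : ℕ) : ℕ :=
  ⌈(n : ℝ) / ((M : ℝ) * (k : ℝ))⌉₊

/-- The `i`-th block of `M * k` consecutive entries (fewer in the last block) of an enumeration
`u`; indices and blocks are counted from zero. -/
def group {n : ℕ} (u : Fin n ↪ Plane) (M k i : ℕ) : Finset Plane :=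
  (Finset.univ.filter fun j : Fin n => i * (M * k) ≤ (j : ℕ) ∧ (j : ℕ) < (i + 1) * (M * k)).map u

/-- A run of the algorithm with parameter `M` on the instance `(V, O, k)`. The way in which ties in
the order are broken and the choice of the approximate solutions are left open, so that all
possible executions are included. -/
structure AlgorithmRun (M : ℕ) (V : Finset Plane) (O : Plane) (k : ℕ) where
  /-- The polar angles used for sorting. -/
  θ : Plane → ℝ
  isPolarAngle : ∀ v ∈ V, IsPolarAngle O v (θ v)
  /-- The terminals in sorted order. -/
  u : Fin V.card ↪ Plane
  enumerates : Finset.univ.map u = V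
  sorted : ∀ i j, i ≤ j → θ (u i) ≤ θ (u j)
  /-- The approximate solutions of the subproblems. -/
  S : Fin (numGroups V.card M k) → List (List Plane)
  isApprox : ∀ i : Fin (numGroups V.card M k),
    IsApproxSolution (1 + 1 / (M : ℝ)) (group u M k (i : ℕ)) O k (S i)

/-- The solution returned by a run of the algorithm: the union of the solutions of all
subproblems. -/
def AlgorithmRun.output {M : ℕ} {V : Finset Plane} {O : Plane} {k : ℕ}
    (A : AlgorithmRun M V O k) : List (List Plane) :=
  (List.ofFn A.S).flatten

end CVRP

end

/-!
The bound is a sum over the groups of two estimates.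

*Inside a group* (`opt_le_closedLength_add`): by iterated tour partitioning, a closed walk through
the depot and the terminals of a group can be cut into tours of at most `k` terminals at an extra
cost of at most the radial cost of the group. Of the `k` ways to choose the first cut, one is at
most as expensive as the average, and on average every terminal pays `2 / k` times its distance to
the depot (`sum_greedyCost_le`).

*Between the groups* (`exists_closed_walks_of_tour`): an optimal tour on all terminals is turned
into one closed walk per group, with `4 * D` of extra length for each. The terminals of a group
lie in a wedge with apex `O`, bounded by the rays through its first and its last terminal, and
these wedges do not overlap. Hence a tour edge between two groups leaves the first wedge before it
enters the second one (`exists_crossings_of_wedges`), so cutting the tour there leaves every group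
with fragments that end on the boundary of its wedge and that have total length at most that of
the tour (`exists_fragments_of_path`). Inside the disc of radius `D` around `O` this boundary is a
curve of length `2 * D`, and using it at most twice suffices to join all the fragments of the
group to a closed walk through `O` (`exists_closed_walk_of_fragments`).

Working with the two rays instead of the perimeter of a convex region avoids any distinction
between wedges of angle below and above `π`, and `4 ≤ 3 * π / 2` gives the constant claimed. The
tour is cut open at the first terminal of the first group, which lies on the boundary of its
wedge; this covers the case of a single group too.
-/

noncomputable section

namespace CVRP

/-! ### Lengths of polygonal paths and closed walks -/

lemma pathLength_nonneg (l : List Plane) : 0 ≤ pathLength l := by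
  induction l with
  | nil => simp [pathLength]
  | cons a l ih =>
    cases l with
    | nil => simp [pathLength]
    | cons b l => simpa only [pathLength] using add_nonneg dist_nonneg ih

lemma pathLength_cons_cons (a b : Plane) (l : List Plane) :
    pathLength (a :: b :: l) = dist a b + pathLength (b :: l) := rfl

lemma pathLength_pair (a b : Plane) : pathLength [a, b] = dist a b := by
  simp [pathLength]

lemma pathLength_append_cons (l₁ : List Plane) (x : Plane) (l₂ : List Plane) :
    pathLength (l₁ ++ x :: l₂) = pathLength (l₁ ++ [x]) + pathLength (x :: l₂) := by
  induction l₁ with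
  | nil => simp [pathLength]
  | cons a l ih =>
    cases l with
    | nil => simp [pathLength]
    | cons b l =>
      simp only [List.cons_append, pathLength_cons_cons] at ih ⊢
      rw [ih, add_assoc]

lemma pathLength_reverse (l : List Plane) : pathLength l.reverse = pathLength l := by
  induction l with
  | nil => rfl
  | cons a l ih =>
    cases l with
    | nil => rfl
    | cons b l =>
      rw [List.reverse_cons, List.reverse_cons, List.append_assoc, List.singleton_append,
        pathLength_append_cons, pathLength_pair, ← List.reverse_cons, ih, pathLength_cons_cons,
        dist_comm, add_comm]

lemma pathLength_cons_le (a b : Plane) (l : List Plane) :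
    pathLength (a :: l) ≤ pathLength (a :: b :: l) := by
  cases l with
  | nil => simp [pathLength]
  | cons c l =>
    simp only [pathLength_cons_cons]
    linarith [dist_triangle a b c]

/-- Shortcutting a path with fixed endpoints does not make it longer. -/
lemma pathLength_le_of_sublist {l₁ l₂ : List Plane} (h : l₁.Sublist l₂) (a b : Plane) :
    pathLength (a :: l₁ ++ [b]) ≤ pathLength (a :: l₂ ++ [b]) := by
  induction h generalizing a with
  | slnil => rfl
  | cons c _ ih =>
    refine (ih a).trans ?_
    simp only [List.cons_append]
    exact pathLength_cons_le _ _ _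
  | cons_cons c _ ih =>
    simp only [List.cons_append, pathLength_cons_cons] at ih ⊢
    linarith [ih c]

/-- A closed walk may be started at any of its points. -/
lemma exists_closedLength_cons_eq {l : List Plane} {x : Plane} (hx : x ∈ l) :
    ∃ l', closedLength (x :: l') = closedLength l ∧ ∀ v, v ∈ x :: l' ↔ v ∈ l := by
  obtain ⟨l₁, l₂, rfl⟩ := List.append_of_mem hx
  cases l₁ with
  | nil => exact ⟨l₂, rfl, fun v => Iff.rfl⟩
  | cons a l₁ =>
    refine ⟨l₂ ++ a :: l₁, ?_, fun v => ?_⟩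
    · have h₁ := pathLength_append_cons (x :: l₂) a (l₁ ++ [x])
      have h₂ := pathLength_append_cons (a :: l₁) x (l₂ ++ [a])
      simp only [closedLength, List.cons_append, List.append_assoc] at *
      linarith
    · simp only [List.mem_cons, List.mem_append]
      tauto

/-! ### Iterated tour partitioning -/

/-- Cost of serving the terminals of a list in order with capacity `k` from the current position
`a`, where the current vehicle still has capacity for `r` terminals and a vehicle only returns to
the depot `O` once it is full or no terminal is left. -/
def greedyCost (O : Plane) (k : ℕ) : ℕ → Plane → List Plane → ℝ
  | _, a, [] => dist a O
  | 0, a, b :: l => dist a O + dist O b + greedyCost O k (k - 1) b l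
  | r + 1, a, b :: l => dist a b + greedyCost O k r b l

lemma exists_tours_of_greedyCost (O : Plane) {k : ℕ} (hk : 0 < k) (l : List Plane) :
    ∀ (r : ℕ) (a : Plane), ∃ (t : List Plane) (S : List (List Plane)),
      t.length ≤ r ∧ (∀ t' ∈ S, t'.length ≤ k) ∧ t ++ S.flatten = l ∧
        pathLength (a :: t ++ [O]) + solutionCost O S = greedyCost O k r a l := by
  induction l with
  | nil =>
    intro r a
    exact ⟨[], [], by simp, by simp, rfl, by simp [solutionCost, greedyCost, pathLength]⟩
  | cons b l ih =>
    intro r a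
    cases r with
    | zero =>
      obtain ⟨t, S, h₁, h₂, h₃, h₄⟩ := ih (k - 1) b
      refine ⟨[], (b :: t) :: S, le_rfl, ?_, by simp [h₃], ?_⟩
      · rintro t' ht'
        rcases List.mem_cons.1 ht' with rfl | ht'
        · simp only [List.length_cons]
          omega
        · exact h₂ t' ht'
      · simp only [solutionCost, List.map_cons, List.sum_cons, tourCost, greedyCost,
          List.cons_append, pathLength_cons_cons, List.nil_append, pathLength] at h₄ ⊢
        rw [← h₄]
        ring
    | succ r =>
      obtain ⟨t, S, h₁, h₂, h₃, h₄⟩ := ih r b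
      refine ⟨b :: t, S, by simpa using h₁, h₂, by simp [h₃], ?_⟩
      simp only [greedyCost, ← h₄, List.cons_append, pathLength_cons_cons]
      ring

/-- Summed over the `k` possible loads of the first vehicle, every edge of the walk is cut at most
once and every terminal pays its distance to the depot at most twice. -/
lemma sum_greedyCost_le (O : Plane) {k : ℕ} (hk : 0 < k) (l : List Plane) (a : Plane) :
    ∑ r ∈ Finset.range k, greedyCost O k r a l ≤
      k * pathLength (a :: l ++ [O]) + dist a O + 2 * (l.map (dist O)).sum := by
  induction l generalizing a with
  | nil => simp [greedyCost, pathLength]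
  | cons b l ih =>
    obtain ⟨m, rfl⟩ := Nat.exists_eq_add_of_lt hk
    have h := ih b
    rw [zero_add] at *
    rw [Finset.sum_range_succ] at h
    rw [Finset.sum_range_succ']
    simp only [greedyCost, Finset.sum_add_distrib, Finset.sum_const, Finset.card_range,
      nsmul_eq_mul, List.cons_append, pathLength_cons_cons, List.map_cons, List.sum_cons,
      Nat.add_sub_cancel] at h ⊢
    push_cast at h ⊢
    have := dist_nonneg (x := a) (y := b)
    rw [dist_comm b O] at h
    linarith

lemma tourCost_nonneg (O : Plane) (t : List Plane) : 0 ≤ tourCost O t := pathLength_nonneg _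

lemma solutionCost_nonneg (O : Plane) (S : List (List Plane)) : 0 ≤ solutionCost O S := by
  refine List.sum_nonneg fun x hx => ?_
  obtain ⟨t, -, rfl⟩ := List.mem_map.1 hx
  exact tourCost_nonneg O t

lemma opt_le_solutionCost {U : Finset Plane} {k : ℕ} {S : List (List Plane)}
    (hS : IsSolution U k S) (O : Plane) : opt U O k ≤ solutionCost O S := by
  refine csInf_le ⟨0, ?_⟩ ⟨S, hS, rfl⟩
  rintro _ ⟨S', -, rfl⟩
  exact solutionCost_nonneg O S'

/-- Iterated tour partitioning: a closed walk through the depot and all terminals yields a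
solution that costs at most the length of the walk plus the radial cost. -/
lemma opt_le_closedLength_add {U : Finset Plane} {O : Plane} {k : ℕ} (hk : 0 < k)
    {W : List Plane} (hO : O ∈ W) (hU : ∀ v ∈ U, v ∈ W) :
    opt U O k ≤ closedLength W + 2 / (k : ℝ) * ∑ v ∈ U, dist O v := by
  classical
  obtain ⟨l, hl, hmem⟩ := exists_closedLength_cons_eq hO
  -- The depot itself may be a terminal, so it is kept as a possible first stop.
  set l' := ((O :: l).filter (· ∈ U)).dedup with hl'
  have hsub : l'.Sublist (O :: l) := (List.dedup_sublist _).trans List.filter_sublist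
  have hnd : l'.Nodup := List.nodup_dedup _
  have hmem' : ∀ v, v ∈ l' ↔ v ∈ U := by
    intro v
    rw [hl', List.mem_dedup, List.mem_filter, hmem]
    simpa using hU v
  have hlen : pathLength (O :: l' ++ [O]) ≤ closedLength W := by
    refine (pathLength_le_of_sublist hsub O O).trans ?_
    rw [← hl]
    simp [closedLength, pathLength_cons_cons]
  have hsum : (l'.map (dist O)).sum = ∑ v ∈ U, dist O v := by
    rw [← List.sum_toFinset _ hnd]
    refine Finset.sum_congr ?_ fun _ _ => rfl
    ext v
    rw [List.mem_toFinset, hmem']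
  have hk' : (0 : ℝ) < k := by exact_mod_cast hk
  obtain ⟨r, hr, hle⟩ : ∃ r ∈ Finset.range k, greedyCost O k r O l' ≤
      closedLength W + 2 / (k : ℝ) * ∑ v ∈ U, dist O v := by
    refine Finset.exists_le_of_sum_le ⟨0, Finset.mem_range.2 hk⟩ ?_
    refine (sum_greedyCost_le O hk l' O).trans ?_
    rw [hsum, dist_self, Finset.sum_const, Finset.card_range, nsmul_eq_mul, mul_add]
    have := mul_le_mul_of_nonneg_left hlen hk'.le
    have h2 : (k : ℝ) * (2 / (k : ℝ) * ∑ v ∈ U, dist O v) = 2 * ∑ v ∈ U, dist O v := by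
      field_simp
    linarith
  obtain ⟨t, S, h₁, h₂, h₃, h₄⟩ := exists_tours_of_greedyCost O hk l' r O
  have hcap : ∀ t' ∈ t :: S, t'.length ≤ k := by
    intro t' ht'
    rcases List.mem_cons.1 ht' with rfl | ht'
    · exact h₁.trans (Finset.mem_range.1 hr).le
    · exact h₂ t' ht'
  have hfl : ∀ v, (∃ t' ∈ t :: S, v ∈ t') ↔ v ∈ U := by
    intro v
    rw [← hmem', ← h₃, ← List.flatten_cons, List.mem_flatten]
  refine (opt_le_solutionCost (S := t :: S) ⟨?_, ?_, ?_⟩ O).trans ?_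
  · exact fun t' ht' v hv => (hfl v).1 ⟨t', ht', hv⟩
  · intro t' ht'
    have : {v | v ∈ t'} = (t'.toFinset : Set Plane) := by
      ext v
      simp
    rw [this, Set.ncard_coe_finset]
    exact (List.toFinset_card_le t').trans (hcap t' ht')
  · exact fun v hv => (hfl v).2 hv
  · rw [solutionCost, List.map_cons, List.sum_cons, tourCost]
    rw [solutionCost] at h₄
    linarith

/-! ### Stitching fragments whose endpoints lie on a curve -/

/-- A polygonal path with endpoints `γ s` and `γ t` on a curve `γ : ℝ → Plane` (left implicit)
and the points of `stops` in between. -/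
structure Fragment where
  /-- Parameter of the initial point. -/
  s : ℝ
  /-- The intermediate points, in order. -/
  stops : List Plane
  /-- Parameter of the final point. -/
  t : ℝ

/-- Length of a fragment with respect to the curve `γ` that carries its endpoints. -/
def Fragment.length (γ : ℝ → Plane) (f : Fragment) : ℝ :=
  pathLength (γ f.s :: f.stops ++ [γ f.t])

/-- The endpoints of the fragment have parameters in `[a, b]`. -/
def Fragment.Within (a b : ℝ) (f : Fragment) : Prop :=
  f.s ∈ Set.Icc a b ∧ f.t ∈ Set.Icc a b

/-- A fragment with the smallest endpoint, oriented to start there, can be split off. -/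
lemma exists_lowest_fragment (γ : ℝ → Plane) {a b : ℝ} {F : Multiset Fragment} (hF : F ≠ 0)
    (hw : ∀ f ∈ F, f.Within a b) :
    ∃ (f : Fragment) (F' : Multiset Fragment), f.Within a b ∧ f.s ≤ f.t ∧
      (∀ f' ∈ F, f'.Within f.s b) ∧ F' ⊆ F ∧ F.card = F'.card + 1 ∧
      (F.map (Fragment.length γ)).sum = f.length γ + (F'.map (Fragment.length γ)).sum ∧
      ∀ f' ∈ F, ∀ v ∈ f'.stops, v ∈ f.stops ∨ ∃ f'' ∈ F', v ∈ f''.stops := by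
  classical
  obtain ⟨f, hf, hmin⟩ := Finset.exists_min_image F.toFinset (fun f => min f.s f.t)
    (Multiset.toFinset_nonempty.2 hF)
  rw [Multiset.mem_toFinset] at hf
  obtain ⟨F', rfl⟩ := Multiset.exists_cons_of_mem hf
  have hmin' : ∀ f' ∈ f ::ₘ F', f'.Within (min f.s f.t) b := by
    intro f' hf'
    have h₁ := hmin f' (Multiset.mem_toFinset.2 hf')
    have h₂ := hw f' hf'
    exact ⟨⟨h₁.trans (min_le_left _ _), h₂.1.2⟩, ⟨h₁.trans (min_le_right _ _), h₂.2.2⟩⟩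
  have hfw := hw f hf
  rcases le_total f.s f.t with h | h
  · refine ⟨f, F', hfw, h, ?_, Multiset.subset_cons _ _, by simp, by simp, ?_⟩
    · rwa [min_eq_left h] at hmin'
    · intro f' hf' v hv
      rcases Multiset.mem_cons.1 hf' with rfl | hf'
      · exact Or.inl hv
      · exact Or.inr ⟨f', hf', hv⟩
  · refine ⟨⟨f.t, f.stops.reverse, f.s⟩, F', ⟨hfw.2, hfw.1⟩, h, ?_,
      Multiset.subset_cons _ _, by simp, ?_, ?_⟩
    · rwa [min_eq_right h] at hmin'
    · have : Fragment.length γ ⟨f.t, f.stops.reverse, f.s⟩ = f.length γ := by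
        simp only [Fragment.length]
        rw [← pathLength_reverse]
        simp
      rw [this]
      simp
    · intro f' hf' v hv
      rcases Multiset.mem_cons.1 hf' with rfl | hf'
      · exact Or.inl (by simpa using hv)
      · exact Or.inr ⟨f', hf', hv⟩

/-- Fragments with endpoints on `γ '' [a, b]` can be joined to one closed walk at an extra cost
that does not depend on their number. The induction consumes the two lowest endpoints `s ≤ s'`:
they are joined by the detour `s → a → s'`, which either closes a fragment or merges two. -/
lemma exists_closed_walk_of_fragments {γ : ℝ → Plane} (hγ : ∀ s t, dist (γ s) (γ t) ≤ |s - t|)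
    (b : ℝ) (n : ℕ) : ∀ (F : Multiset Fragment) (a : ℝ), F.card = n → a ≤ b →
      (∀ f ∈ F, f.Within a b) →
      ∃ W : List Plane, γ a ∈ W ∧ (∀ f ∈ F, ∀ v ∈ f.stops, v ∈ W) ∧
        closedLength W ≤ (F.map (Fragment.length γ)).sum + 2 * (b - a) := by
  have hγ' : ∀ {s t : ℝ}, s ≤ t → dist (γ s) (γ t) ≤ t - s := fun {s t} h => by
    have := hγ s t
    rwa [abs_sub_comm, abs_of_nonneg (sub_nonneg.2 h)] at this
  induction n using Nat.strong_induction_on with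
  | _ n ih =>
  intro F a hcard hab hw
  by_cases hF : F = 0
  · subst hF
    exact ⟨[γ a], by simp, by simp, by simpa [closedLength, pathLength] using hab⟩
  obtain ⟨f, F', hfw, hst, hw', hsub, hc', hsum, hcont⟩ := exists_lowest_fragment γ hF hw
  obtain ⟨⟨has, hsb⟩, hat, htb⟩ := hfw
  by_cases hlow : ∀ f' ∈ F', f'.Within f.t b
  · -- The second lowest endpoint belongs to the same fragment, which is thereby closed.
    obtain ⟨W, hW, hWc, hWl⟩ := ih F'.card (by omega) F' f.t rfl htb hlow
    obtain ⟨W', hl, hmem⟩ := exists_closedLength_cons_eq hW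
    refine ⟨γ a :: γ f.s :: f.stops ++ γ f.t :: W' ++ [γ f.t], by simp, ?_, ?_⟩
    · intro f' hf' v hv
      rcases hcont f' hf' v hv with h | ⟨f'', hf'', h⟩
      · simp [h]
      · have := (hmem v).2 (hWc f'' hf'' v h)
        simp only [List.mem_cons, List.mem_append] at this ⊢
        tauto
    · have e₁ := pathLength_append_cons (γ f.s :: f.stops) (γ f.t) (W' ++ [γ f.t, γ a])
      have e₂ := pathLength_append_cons (γ f.t :: W') (γ f.t) [γ a]
      have d₁ := hγ' has
      have d₂ := hγ' hat
      rw [dist_comm] at d₂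
      simp only [closedLength, List.cons_append, List.append_assoc, pathLength_cons_cons,
        List.nil_append, Fragment.length, pathLength] at *
      linarith
  · -- The second lowest endpoint belongs to another fragment, and the two are merged.
    have hF' : F' ≠ 0 := by
      rintro rfl
      simp at hlow
    obtain ⟨g, G, hgw, hgst, hw'', hsub', hc'', hsum', hcont'⟩ := exists_lowest_fragment γ hF'
      fun f' hf' => hw' f' (hsub hf')
    obtain ⟨⟨hs', -⟩, -, hgtb⟩ := hgw
    have hlt : g.s < f.t := by
      by_contra! hle
      refine hlow fun f' hf' => ?_
      obtain ⟨⟨h₁, h₂⟩, h₃, h₄⟩ := hw'' f' hf'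
      exact ⟨⟨hle.trans h₁, h₂⟩, hle.trans h₃, h₄⟩
    obtain ⟨W, -, hWc, hWl⟩ := ih (G.card + 1) (by omega)
      ((⟨f.t, f.stops.reverse ++ γ f.s :: γ a :: γ g.s :: g.stops, g.t⟩ : Fragment) ::ₘ G) g.s
      (by simp) (by linarith) (by
        intro f' hf'
        rcases Multiset.mem_cons.1 hf' with rfl | hf'
        · exact ⟨⟨hlt.le, htb⟩, hgst, hgtb⟩
        · exact hw'' f' (hsub' hf'))
    have hnew := hWc _ (Multiset.mem_cons_self _ _)
    refine ⟨W, hnew _ (by simp), ?_, ?_⟩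
    · intro f' hf' v hv
      rcases hcont f' hf' v hv with h | ⟨f'', hf'', h⟩
      · exact hnew v (by simp [h])
      · rcases hcont' f'' hf'' v h with h | ⟨f₃, hf₃, h⟩
        · exact hnew v (by simp [h])
        · exact hWc f₃ (Multiset.mem_cons_of_mem hf₃) v h
    · refine hWl.trans ?_
      have e₁ := pathLength_append_cons (γ f.t :: f.stops.reverse) (γ f.s)
        (γ a :: γ g.s :: g.stops ++ [γ g.t])
      have e₂ : pathLength (γ f.t :: f.stops.reverse ++ [γ f.s]) = f.length γ := by
        rw [Fragment.length, ← pathLength_reverse]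
        simp
      have d₁ := hγ' has
      have d₂ := hγ' (has.trans hs')
      rw [dist_comm] at d₁
      rw [Multiset.map_cons, Multiset.sum_cons, hsum, hsum']
      simp only [Fragment.length, List.cons_append, List.append_assoc,
        pathLength_cons_cons] at *
      linarith

/-! ### Rays, wedges and crossings of their boundary -/

/-- The point at distance `r` (if `0 ≤ r`) from `O` in direction `φ`. -/
def ray (O : Plane) (φ r : ℝ) : Plane := O + r • !₂[Real.cos φ, Real.sin φ]

lemma norm_direction (φ : ℝ) : ‖(!₂[Real.cos φ, Real.sin φ] : Plane)‖ = 1 := by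
  rw [EuclideanSpace.norm_eq]
  simp

lemma dist_ray_self (O : Plane) (φ : ℝ) {r : ℝ} (hr : 0 ≤ r) : dist (ray O φ r) O = r := by
  rw [ray, dist_eq_norm, add_sub_cancel_left, norm_smul, norm_direction, mul_one,
    Real.norm_of_nonneg hr]

lemma ray_sub_two_pi (O : Plane) (φ r : ℝ) : ray O (φ - 2 * Real.pi) r = ray O φ r := by
  simp [ray, Real.cos_sub_two_pi, Real.sin_sub_two_pi]

lemma ray_zero (O : Plane) (φ : ℝ) : ray O φ 0 = O := by simp [ray]

lemma IsPolarAngle.eq_ray {O v : Plane} {t : ℝ} (h : IsPolarAngle O v t) :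
    v = ray O t (dist O v) := by
  obtain ⟨-, -, h₀, h₁⟩ := h
  rw [dist_comm] at h₀ h₁ ⊢
  ext i
  fin_cases i
  · simpa [ray, dist_comm] using h₀
  · simpa [ray, dist_comm] using h₁

/-- A segment whose endpoints have directions `a ≤ c` with `c - a ≤ π` meets every ray in between.
The point has weights `s * sin (c - b)` and `r * sin (b - a)`, up to normalization. -/
lemma exists_wbtw_ray (O : Plane) {a b c r s : ℝ} (hab : a ≤ b) (hbc : b ≤ c)
    (hac : c - a ≤ Real.pi) (hr : 0 ≤ r) (hs : 0 ≤ s) :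
    ∃ t, 0 ≤ t ∧ Wbtw ℝ (ray O a r) (ray O b t) (ray O c s) := by
  rcases hab.eq_or_lt with rfl | hab
  · exact ⟨r, hr, wbtw_self_left ℝ _ _⟩
  rcases hbc.eq_or_lt with rfl | hbc
  · exact ⟨s, hs, wbtw_self_right ℝ _ _⟩
  rcases hr.eq_or_lt with rfl | hr
  · refine ⟨0, le_rfl, ?_⟩
    rw [ray_zero, ray_zero]
    exact wbtw_self_left ℝ _ _
  have hA : 0 < r * Real.sin (b - a) :=
    mul_pos hr (Real.sin_pos_of_pos_of_lt_pi (by linarith) (by linarith))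
  have hB : 0 ≤ s * Real.sin (c - b) :=
    mul_nonneg hs (Real.sin_nonneg_of_nonneg_of_le_pi (by linarith) (by linarith))
  have hC : 0 ≤ Real.sin (c - a) := Real.sin_nonneg_of_nonneg_of_le_pi (by linarith) hac
  set A := r * Real.sin (b - a) with hAd
  set B := s * Real.sin (c - b) with hBd
  have hAB : 0 < A + B := by linarith
  refine ⟨r * s * Real.sin (c - a) / (A + B), by positivity, A / (A + B),
    ⟨by positivity, (div_le_one hAB).2 (by linarith)⟩, ?_⟩
  ext i
  fin_cases i
  · simp only [AffineMap.lineMap_apply, ray, vsub_eq_sub, vadd_eq_add, PiLp.add_apply,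
      PiLp.smul_apply, PiLp.sub_apply, smul_eq_mul, Fin.zero_eta, Fin.isValue,
      Matrix.cons_val_zero]
    field_simp
    rw [hAd, hBd, Real.sin_sub, Real.sin_sub, Real.sin_sub]
    ring
  · simp only [AffineMap.lineMap_apply, ray, vsub_eq_sub, vadd_eq_add, PiLp.add_apply,
      PiLp.smul_apply, PiLp.sub_apply, smul_eq_mul, Fin.mk_one, Fin.isValue,
      Matrix.cons_val_one, Matrix.cons_val_zero]
    field_simp
    rw [hAd, hBd, Real.sin_sub, Real.sin_sub, Real.sin_sub]
    ring

lemma wbtw_ray_le {O x y : Plane} {D φ t : ℝ} (ht : 0 ≤ t) (hx : dist x O ≤ D)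
    (hy : dist y O ≤ D) (h : Wbtw ℝ x (ray O φ t) y) : t ≤ D := by
  have := (convex_closedBall O D).segment_subset (Metric.mem_closedBall.2 hx)
    (Metric.mem_closedBall.2 hy) (mem_segment_iff_wbtw.2 h)
  rwa [Metric.mem_closedBall, dist_ray_self O φ ht] at this

/-- A segment turning through at most `π` crosses two intermediate rays in their order. -/
lemma exists_two_crossings (O : Plane) {a b c d r s D : ℝ} (hab : a ≤ b) (hbc : b ≤ c)
    (hcd : c ≤ d) (had : d - a ≤ Real.pi) (hr : 0 ≤ r) (hs : 0 ≤ s) (hrD : r ≤ D) (hsD : s ≤ D) :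
    ∃ x ∈ Set.Icc 0 D, ∃ y ∈ Set.Icc 0 D,
      dist (ray O a r) (ray O b x) + dist (ray O c y) (ray O d s) ≤
        dist (ray O a r) (ray O d s) := by
  obtain ⟨x, hx, hxw⟩ := exists_wbtw_ray O hab (hbc.trans hcd) had hr hs
  obtain ⟨y, hy, hyw⟩ := exists_wbtw_ray O hbc hcd (by linarith) hx hs
  have hr' : dist (ray O a r) O ≤ D := by rwa [dist_ray_self O a hr]
  have hs' : dist (ray O d s) O ≤ D := by rwa [dist_ray_self O d hs]
  have hxD := wbtw_ray_le hx hr' hs' hxw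
  have hyD := wbtw_ray_le hy (by rwa [dist_ray_self O b hx]) hs' hyw
  refine ⟨x, ⟨hx, hxD⟩, y, ⟨hy, hyD⟩, ?_⟩
  rw [← hxw.dist_add_dist, ← hyw.dist_add_dist]
  linarith [dist_nonneg (x := ray O b x) (y := ray O c y)]

/-- The boundary of the wedge with apex `O` between the directions `α` and `β`, traversed by arc
length: positive parameters give the ray of direction `α`, negative ones that of `β`. -/
def wedgeBoundary (O : Plane) (α β s : ℝ) : Plane :=
  O + (max s 0 • !₂[Real.cos α, Real.sin α] + max (-s) 0 • !₂[Real.cos β, Real.sin β])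

lemma wedgeBoundary_of_nonneg (O : Plane) (α β : ℝ) {s : ℝ} (hs : 0 ≤ s) :
    wedgeBoundary O α β s = ray O α s := by
  simp [wedgeBoundary, ray, hs]

lemma wedgeBoundary_neg (O : Plane) (α β : ℝ) {s : ℝ} (hs : 0 ≤ s) :
    wedgeBoundary O α β (-s) = ray O β s := by
  simp [wedgeBoundary, ray, hs]

lemma dist_wedgeBoundary_le (O : Plane) (α β s t : ℝ) :
    dist (wedgeBoundary O α β s) (wedgeBoundary O α β t) ≤ |s - t| := by
  have key : |max s 0 - max t 0| + |max (-s) 0 - max (-t) 0| ≤ |s - t| := by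
    rcases le_total s 0 with hs | hs <;> rcases le_total t 0 with ht | ht <;>
      simp only [hs, ht, max_eq_left, max_eq_right, neg_nonneg, neg_nonpos, sub_zero, zero_sub,
        sub_self, abs_zero, add_zero, zero_add, abs_neg]
    · rw [sub_neg_eq_add, neg_add_eq_sub, abs_sub_comm]
    · rw [abs_of_nonpos hs, abs_of_nonneg ht, abs_of_nonpos (by linarith)]
      linarith
    · rw [abs_of_nonneg hs, abs_of_nonpos ht, abs_of_nonneg (by linarith)]
      linarith
    · exact le_rfl
  refine le_trans ?_ key
  rw [wedgeBoundary, wedgeBoundary, dist_add_left]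
  refine (dist_add_add_le _ _ _ _).trans (add_le_add ?_ ?_) <;>
    rw [dist_eq_norm, ← sub_smul, norm_smul, norm_direction, mul_one, Real.norm_eq_abs]

/-- An edge between terminals of different wedges leaves the first one before it enters the
second one. If the angle between the terminals exceeds `π`, the edge passes through the direction
`0 = 2 * π` and crosses the outer rays of the two wedges instead of the inner ones. -/
lemma exists_crossings_of_wedges {O v w : Plane} {D θ₁ θ₂ α₁ β₁ α₂ β₂ : ℝ}
    (hv : v = ray O θ₁ (dist O v)) (hw : w = ray O θ₂ (dist O w))
    (hvD : dist O v ≤ D) (hwD : dist O w ≤ D) (hα : 0 ≤ α₁) (h₁ : θ₁ ∈ Set.Icc α₁ β₁)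
    (h₁₂ : β₁ ≤ α₂) (h₂ : θ₂ ∈ Set.Icc α₂ β₂) (hβ : β₂ < 2 * Real.pi) :
    ∃ s ∈ Set.Icc (-D) D, ∃ t ∈ Set.Icc (-D) D,
      dist v (wedgeBoundary O α₁ β₁ s) + dist (wedgeBoundary O α₂ β₂ t) w ≤ dist v w := by
  obtain ⟨h₁, h₁'⟩ := h₁
  obtain ⟨h₂, h₂'⟩ := h₂
  rcases le_total (θ₂ - θ₁) Real.pi with h | h
  · obtain ⟨x, ⟨hx, hxD⟩, y, ⟨hy, hyD⟩, hxy⟩ := exists_two_crossings O h₁' h₁₂ h₂ h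
      dist_nonneg dist_nonneg hvD hwD
    rw [← hv, ← hw] at hxy
    refine ⟨-x, ⟨by linarith, by linarith⟩, y, ⟨by linarith, hyD⟩, ?_⟩
    rwa [wedgeBoundary_neg O _ _ hx, wedgeBoundary_of_nonneg O _ _ hy]
  · obtain ⟨x, ⟨hx, hxD⟩, y, ⟨hy, hyD⟩, hxy⟩ := exists_two_crossings O
      (a := θ₂ - 2 * Real.pi) (b := β₂ - 2 * Real.pi) (c := α₁) (d := θ₁)
      (by linarith) (by linarith) h₁ (by linarith)
      dist_nonneg dist_nonneg hwD hvD
    rw [ray_sub_two_pi, ray_sub_two_pi, ← hv, ← hw] at hxy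
    refine ⟨y, ⟨by linarith, hyD⟩, -x, ⟨by linarith, by linarith⟩, ?_⟩
    rw [wedgeBoundary_neg O _ _ hx, wedgeBoundary_of_nonneg O _ _ hy, dist_comm v w,
      dist_comm v, dist_comm _ w]
    linarith

/-! ### Cutting a tour at the boundaries of the groups -/

/-- A path whose last point lies on the curve of its group splits into fragments of the groups.
The piece containing the first point `a` is still open at `a`. -/
lemma exists_fragments_of_path {ι : Type*} [DecidableEq ι] {I : Finset ι} {V : Finset Plane}
    {g : Plane → ι} (hg : ∀ v ∈ V, g v ∈ I) {γ : ι → ℝ → Plane} {D : ℝ}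
    (hcross : ∀ v ∈ V, ∀ w ∈ V, g v ≠ g w → ∃ s ∈ Set.Icc (-D) D, ∃ t ∈ Set.Icc (-D) D,
      dist v (γ (g v) s) + dist (γ (g w) t) w ≤ dist v w)
    {z : Plane} {r : ℝ} (hr : r ∈ Set.Icc (-D) D) (hz : z = γ (g z) r) (hzV : z ∈ V)
    (l : List Plane) : ∀ a ∈ V, (∀ v ∈ l, v ∈ V) →
      ∃ (x : List Plane) (t : ℝ) (F : ι → Multiset Fragment), t ∈ Set.Icc (-D) D ∧
        (∀ i, ∀ f ∈ F i, f.Within (-D) D) ∧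
        (∀ v ∈ l, (g v = g a ∧ v ∈ x) ∨ ∃ f ∈ F (g v), v ∈ f.stops) ∧
        pathLength (a :: x ++ [γ (g a) t]) +
          ∑ i ∈ I, ((F i).map (Fragment.length (γ i))).sum ≤ pathLength (a :: l ++ [z]) := by
  induction l with
  | nil =>
    intro a ha _
    by_cases haz : g a = g z
    · refine ⟨[], r, fun _ => 0, hr, by simp, by simp, ?_⟩
      rw [haz, ← hz]
      simp
    · obtain ⟨s, hs, t, ht, hst⟩ := hcross a ha z hzV haz
      refine ⟨[], s, fun _ => 0, hs, by simp, by simp, ?_⟩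
      have := dist_nonneg (x := γ (g z) t) (y := z)
      simp only [List.nil_append, List.cons_append, pathLength_pair, Multiset.map_zero,
        Multiset.sum_zero, Finset.sum_const_zero]
      linarith
  | cons b l ih =>
    intro a ha hl
    have hb : b ∈ V := hl b (by simp)
    obtain ⟨x, t, F, ht, hF, hcont, hlen⟩ := ih b hb fun v hv => hl v (by simp [hv])
    by_cases hab : g a = g b
    · refine ⟨b :: x, t, F, ht, hF, ?_, ?_⟩
      · intro v hv
        rcases List.mem_cons.1 hv with rfl | hv
        · exact Or.inl ⟨hab.symm, by simp⟩
        · rcases hcont v hv with ⟨h₁, h₂⟩ | h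
          · exact Or.inl ⟨h₁.trans hab.symm, by simp [h₂]⟩
          · exact Or.inr h
      · rw [hab]
        simp only [List.cons_append, pathLength_cons_cons] at hlen ⊢
        linarith
    · obtain ⟨s, hs, s', hs', hss⟩ := hcross a ha b hb hab
      set f : Fragment := ⟨s', b :: x, t⟩ with hf
      refine ⟨[], s, fun i => if i = g b then f ::ₘ F i else F i, hs, ?_, ?_, ?_⟩
      · intro i f' hf'
        dsimp only at hf'
        split_ifs at hf' with hi
        · rcases Multiset.mem_cons.1 hf' with rfl | hf'
          · exact ⟨hs', ht⟩
          · exact hF i f' hf'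
        · exact hF i f' hf'
      · intro v hv
        right
        by_cases hvb : g v = g b
        · simp only [hvb, if_true, Multiset.mem_cons]
          rcases List.mem_cons.1 hv with rfl | hv
          · exact ⟨f, Or.inl rfl, by simp [hf]⟩
          · rcases hcont v hv with ⟨-, h⟩ | ⟨f', hf', h⟩
            · exact ⟨f, Or.inl rfl, by simp [hf, h]⟩
            · exact ⟨f', Or.inr (hvb ▸ hf'), h⟩
        · have hv' : v ∈ l := by
            rcases List.mem_cons.1 hv with rfl | hv
            · exact absurd rfl hvb
            · exact hv
          simp only [if_neg hvb]
          exact (hcont v hv').resolve_left fun h => hvb h.1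
      · have hsum : ∑ i ∈ I, ((if i = g b then f ::ₘ F i else F i).map
            (Fragment.length (γ i))).sum =
            f.length (γ (g b)) + ∑ i ∈ I, ((F i).map (Fragment.length (γ i))).sum := by
          rw [← Finset.add_sum_erase _ _ (hg b hb), ← Finset.add_sum_erase I (fun i =>
            ((F i).map (Fragment.length (γ i))).sum) (hg b hb), if_pos rfl, Multiset.map_cons,
            Multiset.sum_cons, add_assoc]
          congr 2
          refine Finset.sum_congr rfl fun i hi => ?_
          rw [if_neg (Finset.ne_of_mem_erase hi)]
        rw [hsum]
        simp only [hf, Fragment.length, List.nil_append, List.cons_append, pathLength_cons_cons,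
          pathLength] at hlen ⊢
        linarith

/-- Closed walks through the depot and the terminals of each group, of total length at most that
of a given tour plus `4 * D` per group: the boundary of a wedge inside the disc of radius `D` has
length `2 * D` and is used at most twice. -/
lemma exists_closed_walks_of_tour {ι : Type*} [DecidableEq ι] {I : Finset ι} {V : Finset Plane}
    {O : Plane} {D : ℝ} (hD : 0 ≤ D) {g : Plane → ι} (hg : ∀ v ∈ V, g v ∈ I) {γ : ι → ℝ → Plane}
    (hγ : ∀ i s t, dist (γ i s) (γ i t) ≤ |s - t|) (hγ₀ : ∀ i, γ i 0 = O)
    (hcross : ∀ v ∈ V, ∀ w ∈ V, g v ≠ g w → ∃ s ∈ Set.Icc (-D) D, ∃ t ∈ Set.Icc (-D) D,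
      dist v (γ (g v) s) + dist (γ (g w) t) w ≤ dist v w)
    {z : Plane} {r : ℝ} (hr : r ∈ Set.Icc (-D) D) (hz : z = γ (g z) r) (hzV : z ∈ V)
    {T : List Plane} (hT : ∀ v, v ∈ T ↔ v ∈ V) :
    ∃ W : ι → List Plane, (∀ i, O ∈ W i) ∧ (∀ v ∈ V, v ∈ W (g v)) ∧
      ∑ i ∈ I, closedLength (W i) ≤ closedLength T + I.card * (4 * D) := by
  obtain ⟨l, hl, hmem⟩ := exists_closedLength_cons_eq ((hT z).2 hzV)
  obtain ⟨x, t, F, ht, hF, hcont, hlen⟩ := exists_fragments_of_path hg hcross hr hz hzV l z hzV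
    fun v hv => (hT v).1 ((hmem v).1 (by simp [hv]))
  -- The trivial fragment at the depot makes every walk pass through it.
  set e : Fragment := ⟨0, [O], 0⟩ with he
  set f : Fragment := ⟨r, z :: x, t⟩ with hf
  have h0 : (0 : ℝ) ∈ Set.Icc (-D) D := ⟨by linarith, hD⟩
  have key : ∀ i, ∃ W : List Plane, O ∈ W ∧ (∀ f' ∈ F i, ∀ v ∈ f'.stops, v ∈ W) ∧
      (i = g z → ∀ v ∈ z :: x, v ∈ W) ∧ closedLength W ≤
        (if i = g z then f.length (γ i) else 0) + ((F i).map (Fragment.length (γ i))).sum +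
          4 * D := by
    intro i
    have hel : e.length (γ i) = 0 := by simp [he, Fragment.length, hγ₀, pathLength]
    obtain ⟨W, -, hWc, hWl⟩ := exists_closed_walk_of_fragments (hγ i) D _
      (e ::ₘ if i = g z then f ::ₘ F i else F i) (-D) rfl (by linarith) (by
        intro f' hf'
        rcases Multiset.mem_cons.1 hf' with rfl | hf'
        · exact ⟨h0, h0⟩
        split_ifs at hf'
        · rcases Multiset.mem_cons.1 hf' with rfl | hf'
          · exact ⟨hr, ht⟩
          · exact hF i f' hf'
        · exact hF i f' hf')
    refine ⟨W, hWc e (by simp) O (by simp [he]), ?_, ?_, ?_⟩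
    · intro f' hf'
      refine hWc f' ?_
      split_ifs <;> simp [hf']
    · intro hi
      exact hWc f (by simp [hi])
    · rw [Multiset.map_cons, Multiset.sum_cons, hel] at hWl
      split_ifs at hWl ⊢
      · rw [Multiset.map_cons, Multiset.sum_cons] at hWl
        linarith
      · linarith
  choose W hW₁ hW₂ hW₃ hW₄ using key
  refine ⟨W, hW₁, ?_, ?_⟩
  · intro v hv
    rcases List.mem_cons.1 ((hmem v).2 ((hT v).2 hv)) with rfl | hvl
    · exact hW₃ _ rfl _ (by simp)
    · rcases hcont v hvl with ⟨h₁, h₂⟩ | ⟨f', hf', h⟩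
      · exact hW₃ _ h₁ v (by simp [h₂])
      · exact hW₂ _ f' hf' v h
  · refine (Finset.sum_le_sum fun i _ => hW₄ i).trans ?_
    rw [Finset.sum_add_distrib, Finset.sum_add_distrib, Finset.sum_ite_eq' I (g z),
      if_pos (hg z hzV), Finset.sum_const, nsmul_eq_mul]
    have hfl : f.length (γ (g z)) = pathLength (z :: x ++ [γ (g z) t]) := by
      simp [hf, Fragment.length, ← hz, pathLength_cons_cons]
    rw [hfl, ← hl, closedLength]
    linarith

/-! ### Evaluation of the cost functions -/

lemma solutionCost_flatten_ofFn (O : Plane) {m : ℕ} (S : Fin m → List (List Plane)) :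
    solutionCost O (List.ofFn S).flatten = ∑ i, solutionCost O (S i) := by
  induction m with
  | zero => simp [solutionCost]
  | succ m ih =>
    have := ih fun i => S i.succ
    rw [Fin.sum_univ_succ, ← this]
    simp [solutionCost, List.ofFn_succ]

lemma radialCost_top (V : Finset Plane) (O : Plane) (k : ℕ) :
    radialCost V O k ∞ = 2 / (k : ℝ) * ∑ v ∈ V, dist O v := by
  simp [radialCost, edist_dist, ENNReal.toReal_ofReal dist_nonneg]

lemma localCost_zero (V : Finset Plane) (O : Plane) : localCost V O 0 = tspCost V := by
  simp [localCost]

lemma closedLength_nonneg (l : List Plane) : 0 ≤ closedLength l := by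
  cases l with
  | nil => simp [closedLength]
  | cons a l => exact pathLength_nonneg _

lemma tspCost_nonneg (P : Finset Plane) : 0 ≤ tspCost P := by
  refine Real.sInf_nonneg ?_
  rintro _ ⟨l, -, rfl⟩
  exact closedLength_nonneg l

lemma le_tspCost {P : Finset Plane} {c : ℝ} (h : ∀ l, IsTSPTour P l → c ≤ closedLength l) :
    c ≤ tspCost P := by
  refine le_csInf ⟨_, P.toList, ⟨P.nodup_toList, fun v => P.mem_toList⟩, rfl⟩ ?_
  rintro _ ⟨l, hl, rfl⟩
  exact h l hl

/-! ### The angular groups -/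

lemma lt_numGroups {n M k i : ℕ} (hMk : 0 < M * k) : i < numGroups n M k ↔ i * (M * k) < n := by
  have h : (0 : ℝ) < (M : ℝ) * k := by exact_mod_cast hMk
  rw [numGroups, Nat.lt_ceil, lt_div_iff₀ h]
  exact_mod_cast Iff.rfl

/-- The optimal solutions of the groups cost in total at most the length of a tour through all
terminals plus the radial cost plus `4 * D` per group. -/
lemma sum_opt_group_le {V : Finset Plane} {O : Plane} {k M : ℕ} (hk : 0 < k) (hM : 0 < M)
    (A : AlgorithmRun M V O k) {D : ℝ} (hVD : ∀ v ∈ V, dist O v ≤ D) (hV : V.Nonempty)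
    {T : List Plane} (hT : IsTSPTour V T) :
    ∑ i ∈ Finset.range (numGroups V.card M k), opt (group A.u M k i) O k ≤
      closedLength T + 2 / (k : ℝ) * ∑ v ∈ V, dist O v +
        numGroups V.card M k * (4 * D) := by
  classical
  set N := M * k with hN
  have hNpos : 0 < N := Nat.mul_pos hM hk
  have hn : 0 < V.card := hV.card_pos
  have hmemV : ∀ v, v ∈ V ↔ ∃ j, A.u j = v := by
    intro v
    conv_lhs => rw [← A.enumerates]
    simp
  have huV : ∀ j, A.u j ∈ V := fun j => (hmemV _).2 ⟨j, rfl⟩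
  have hD : 0 ≤ D := dist_nonneg.trans (hVD _ (huV ⟨0, hn⟩))
  have hdiv : ∀ j : ℕ, j < (j / N + 1) * N := fun j => by
    rw [mul_comm]
    exact Nat.lt_mul_div_succ j hNpos
  obtain ⟨g, hgu⟩ : ∃ g : Plane → ℕ, ∀ j, g (A.u j) = (j : ℕ) / N :=
    ⟨Function.extend A.u (fun j => (j : ℕ) / N) 0, fun j => A.u.injective.extend_apply _ _ _⟩
  have hg : ∀ v ∈ V, g v ∈ Finset.range (numGroups V.card M k) := by
    intro v hv
    obtain ⟨j, rfl⟩ := (hmemV v).1 hv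
    rw [Finset.mem_range, lt_numGroups hNpos, hgu]
    exact (Nat.div_mul_le_self _ _).trans_lt j.2
  have hgroup : ∀ i, group A.u M k i = V.filter fun v => g v = i := by
    intro i
    ext v
    simp only [group, Finset.mem_map, Finset.mem_filter, Finset.mem_univ, true_and, hmemV]
    constructor
    · rintro ⟨j, ⟨h₁, h₂⟩, rfl⟩
      exact ⟨⟨j, rfl⟩, (hgu j).trans (Nat.div_eq_of_lt_le h₁ h₂)⟩
    · rintro ⟨⟨j, rfl⟩, h⟩
      rw [hgu] at h
      subst h
      exact ⟨j, ⟨Nat.div_mul_le_self _ _, hdiv j⟩, rfl⟩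
  -- Positions beyond the end are read as the last one, since the last block may be incomplete.
  set idx : ℕ → Fin V.card := fun j => ⟨min j (V.card - 1), by omega⟩ with hidx
  set α : ℕ → ℝ := fun i => A.θ (A.u (idx (i * N))) with hα
  set β : ℕ → ℝ := fun i => A.θ (A.u (idx ((i + 1) * N - 1))) with hβ
  have hpol : ∀ j, IsPolarAngle O (A.u j) (A.θ (A.u j)) := fun j => A.isPolarAngle _ (huV j)
  have hwedge : ∀ j, A.θ (A.u j) ∈ Set.Icc (α (g (A.u j))) (β (g (A.u j))) := by
    intro j
    rw [hgu]
    have h₁ := Nat.div_mul_le_self (j : ℕ) N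
    have h₂ := hdiv j
    have hj := j.2
    constructor
    · refine A.sorted _ _ (Fin.le_def.2 ?_)
      simp only [hidx]
      omega
    · refine A.sorted _ _ (Fin.le_def.2 ?_)
      simp only [hidx]
      omega
  have hsep : ∀ i i', i < i' → β i ≤ α i' := by
    intro i i' h
    refine A.sorted _ _ (Fin.le_def.2 ?_)
    have : (i + 1) * N ≤ i' * N := Nat.mul_le_mul_right _ h
    simp only [hidx]
    omega
  have hcross' : ∀ v ∈ V, ∀ w ∈ V, g v < g w → ∃ s ∈ Set.Icc (-D) D, ∃ t ∈ Set.Icc (-D) D,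
      dist v (wedgeBoundary O (α (g v)) (β (g v)) s) +
        dist (wedgeBoundary O (α (g w)) (β (g w)) t) w ≤ dist v w := by
    intro v hv w hw h
    obtain ⟨j, rfl⟩ := (hmemV v).1 hv
    obtain ⟨j', rfl⟩ := (hmemV w).1 hw
    exact exists_crossings_of_wedges (hpol j).eq_ray (hpol j').eq_ray (hVD _ hv) (hVD _ hw)
      (hpol _).1 (hwedge j) (hsep _ _ h) (hwedge j') (hpol _).2.1
  -- The tour is cut at the first terminal, which lies on the boundary of its wedge.
  have hz : A.u (idx 0) = wedgeBoundary O (α (g (A.u (idx 0)))) (β (g (A.u (idx 0))))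
      (dist O (A.u (idx 0))) := by
    have : g (A.u (idx 0)) = 0 := by simp [hgu, hidx]
    rw [wedgeBoundary_of_nonneg O _ _ dist_nonneg, this]
    simpa [hα] using (hpol (idx 0)).eq_ray
  obtain ⟨W, hW₁, hW₂, hW₃⟩ := exists_closed_walks_of_tour (V := V) (O := O) hD hg
    (γ := fun i => wedgeBoundary O (α i) (β i)) (fun i => dist_wedgeBoundary_le O (α i) (β i))
    (fun i => by rw [wedgeBoundary_of_nonneg O _ _ le_rfl, ray_zero])
    (fun v hv w hw hvw => by
      rcases hvw.lt_or_gt with h | h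
      · exact hcross' v hv w hw h
      · obtain ⟨s, hs, t, ht, hst⟩ := hcross' w hw v hv h
        refine ⟨t, ht, s, hs, ?_⟩
        rw [dist_comm v w, dist_comm v, dist_comm _ w]
        linarith)
    ⟨by linarith [dist_nonneg (x := O) (y := A.u (idx 0))], hVD _ (huV _)⟩ hz (huV _) hT.2
  have hopt : ∀ i, opt (group A.u M k i) O k ≤
      closedLength (W i) + 2 / (k : ℝ) * ∑ v ∈ V with g v = i, dist O v := by
    intro i
    rw [hgroup]
    refine opt_le_closedLength_add hk (hW₁ i) fun v hv => ?_
    obtain ⟨hvV, rfl⟩ := Finset.mem_filter.1 hv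
    exact hW₂ v hvV
  refine (Finset.sum_le_sum fun i _ => hopt i).trans ?_
  rw [Finset.sum_add_distrib, ← Finset.mul_sum, Finset.sum_fiberwise_of_maps_to hg]
  rw [Finset.card_range] at hW₃
  linarith

end CVRP

end

theorem theorem3 (V : Finset CVRP.Plane) (O : CVRP.Plane) (k : ℕ) (hk : 0 < k)
    (M : ℕ) (hM : 0 < M) (A : CVRP.AlgorithmRun M V O k) :
    CVRP.solutionCost O A.output ≤
      (1 + 1 / (M : ℝ)) *
        (CVRP.localCost V O 0 + CVRP.radialCost V O k ∞ +
          3 * Real.pi * Metric.diam (insert O (V : Set CVRP.Plane)) / 2 *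
            (⌈(V.card : ℝ) / ((M : ℝ) * (k : ℝ))⌉₊ : ℝ)) := by
  set D := Metric.diam (insert O (V : Set CVRP.Plane)) with hD
  have hD₀ : 0 ≤ D := Metric.diam_nonneg
  have hVD : ∀ v ∈ V, dist O v ≤ D := fun v hv =>
    Metric.dist_le_diam_of_mem (V.finite_toSet.insert O).isBounded (Set.mem_insert _ _)
      (Set.mem_insert_of_mem _ hv)
  have hα : (0 : ℝ) ≤ 1 + 1 / (M : ℝ) := by positivity
  have hcost : CVRP.solutionCost O A.output ≤ (1 + 1 / (M : ℝ)) *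
      ∑ i ∈ Finset.range (CVRP.numGroups V.card M k), CVRP.opt (CVRP.group A.u M k i) O k := by
    rw [CVRP.AlgorithmRun.output, CVRP.solutionCost_flatten_ofFn,
      ← Fin.sum_univ_eq_sum_range fun i => CVRP.opt (CVRP.group A.u M k i) O k, Finset.mul_sum]
    exact Finset.sum_le_sum fun i _ => (A.isApprox i).2
  refine hcost.trans (mul_le_mul_of_nonneg_left ?_ hα)
  rw [CVRP.localCost_zero, CVRP.radialCost_top]
  change _ ≤ _ + _ + 3 * Real.pi * D / 2 * (CVRP.numGroups V.card M k : ℝ)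
  rcases V.eq_empty_or_nonempty with rfl | hV
  · simpa [CVRP.numGroups] using CVRP.tspCost_nonneg ∅
  have key := CVRP.le_tspCost fun T hT =>
    sub_le_iff_le_add.2 (sub_le_iff_le_add.2 (CVRP.sum_opt_group_le hk hM A hVD hV hT))
  have hπ : 4 * D ≤ 3 * Real.pi * D / 2 := by nlinarith [Real.pi_gt_three]
  have := mul_le_mul_of_nonneg_left hπ (Nat.cast_nonneg (α := ℝ) (CVRP.numGroups V.card M k))
  linarith
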